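/- Let $Z_1,Z_2,Z_3\in\mathbb R^2$ be three non-collinear points (sensors) and $d_1,d_2,d_3\ge 0$ (measured distances). For the squared distance error $\psi(y)=y^2$ let $$O(W)=\sum_{i=1}^3\bigl|\psi(\|W-Z_i\|)-\psi(d_i)\bigr|=\sum_{i=1}^3\bigl|\,\|W-Z_i\|^2-d_i^2\,\bigr|,$$ and let $X=\{W\in\mathbb R^2: O(W)=\min_{\mathbb R^2} O\}$ be the set of its global minimizers. Let $D_i$ be the closed disk with center $Z_i$ and radius $d_i$, let $S_i$ be its boundary circle (a point if $d_i=0$), and put $S_{ij}=S_i\cap S_j$, $S_{123}=S_1\cap S_2\cap S_3$. For $i,j,k\in\{0,1\}$ let $R_{ijk}$ be the closure of the set of points that lie in $D_1$ if and only if $i=1$, in $D_2$ if and only if $j=1$, and in $D_3$ if and only if $k=1$; let $R_l=\bigcup_{i+j+k=l}R_{ijk}$, so that $R_3=D_1\cap D_2\cap D_3$. Let $Y_0=\frac{1}{3}(Z_1+Z_2+Z_3)$, and let $S_{ij}^+$ and $S_{ij}^-$ be the points of $S_{ij}$ that are closest to and farthest from $Y_0$, respectively (no points if $S_{ij}=\emptyset$).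 Consider the condition (E) $S_{123}=\emptyset$, $R_3$ has nonempty interior, and each of $R_{100},R_{010},R_{001}$ is nonempty and connected. 1. If (E) holds, then $X\subset\{S_{12}^\pm,S_{23}^\pm,S_{31}^\pm\}$ and $1\le|X|\le 5$. 2. If (E) does not hold, then $|X|=1$. Moreover, the number of solutions can be $1,2,3,4$ or $5$: for each $m\in\{1,2,3,4,5\}$ there are non-collinear $Z_1,Z_2,Z_3$ and $d_1,d_2,d_3\ge 0$ with $|X|=m$. -/

import Mathlib

noncomputable section

namespace SourceLocalization

/-- The Euclidean plane. -/
abbrev Plane : Type := EuclideanSpace ℝ (Fin 2)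

/-- The objective function `O(W) = ∑ i, |ψ(‖W - Z i‖) - ψ(d i)|` for three sensors `Z i`
with measured distances `d i`. -/
def objective (ψ : ℝ → ℝ) (Z : Fin 3 → Plane) (d : Fin 3 → ℝ) (W : Plane) : ℝ :=
  ∑ i, |ψ ‖W - Z i‖ - ψ (d i)|

/-- The solution set `X`: all global minimizers of the objective function. -/
def solutionSet (ψ : ℝ → ℝ) (Z : Fin 3 → Plane) (d : Fin 3 → ℝ) : Set Plane :=
  {W | ∀ V, objective ψ Z d W ≤ objective ψ Z d V}

/-- The closed measurement disk `D i`. -/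
def disk (Z : Fin 3 → Plane) (d : Fin 3 → ℝ) (i : Fin 3) : Set Plane :=
  Metric.closedBall (Z i) (d i)

/-- The measurement circle `S i`, the boundary of `D i`. -/
def circle (Z : Fin 3 → Plane) (d : Fin 3 → ℝ) (i : Fin 3) : Set Plane :=
  Metric.sphere (Z i) (d i)

/-- `D i` if the index is `1` (`true`), and its complement if the index is `0` (`false`). -/
def side (Z : Fin 3 → Plane) (d : Fin 3 → ℝ) (i : Fin 3) (b : Bool) : Set Plane :=
  if b then disk Z d i else (disk Z d i)ᶜ

/-- The region `R_{ijk}`: the closure of the set of points lying in exactly the disks whose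
index is `1` (`true`). -/
def region (Z : Fin 3 → Plane) (d : Fin 3 → ℝ) (i j k : Bool) : Set Plane :=
  closure (side Z d 0 i ∩ side Z d 1 j ∩ side Z d 2 k)

/-- `R_l`, the union of all `R_{ijk}` with `i + j + k = l`. -/
def levelRegion (Z : Fin 3 → Plane) (d : Fin 3 → ℝ) (l : ℕ) : Set Plane :=
  {W | ∃ i j k : Bool, i.toNat + j.toNat + k.toNat = l ∧ W ∈ region Z d i j k}

/-- `S_{ij} = S_i ∩ S_j`. -/
def circlePair (Z : Fin 3 → Plane) (d : Fin 3 → ℝ) (i j : Fin 3) : Set Plane :=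
  circle Z d i ∩ circle Z d j

/-- `S_{123} = S_1 ∩ S_2 ∩ S_3`. -/
def circleTriple (Z : Fin 3 → Plane) (d : Fin 3 → ℝ) : Set Plane :=
  circle Z d 0 ∩ circle Z d 1 ∩ circle Z d 2

/-- `Y_0`, the centroid of the measurement triangle. -/
def centroid (Z : Fin 3 → Plane) : Plane :=
  (1 / 3 : ℝ) • (Z 0 + Z 1 + Z 2)

/-- `S_{ij}^+`: the points of `S_{ij}` closest to `Y_0`. -/
def nearPoints (Z : Fin 3 → Plane) (d : Fin 3 → ℝ) (i j : Fin 3) : Set Plane :=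
  {W | W ∈ circlePair Z d i j ∧
    ∀ V ∈ circlePair Z d i j, dist W (centroid Z) ≤ dist V (centroid Z)}

/-- `S_{ij}^-`: the points of `S_{ij}` farthest from `Y_0`. -/
def farPoints (Z : Fin 3 → Plane) (d : Fin 3 → ℝ) (i j : Fin 3) : Set Plane :=
  {W | W ∈ circlePair Z d i j ∧
    ∀ V ∈ circlePair Z d i j, dist V (centroid Z) ≤ dist W (centroid Z)}

/-- The set `{S_{12}^±, S_{23}^±, S_{31}^±}`. -/
def candidatePoints (Z : Fin 3 → Plane) (d : Fin 3 → ℝ) : Set Plane :=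
  (nearPoints Z d 0 1 ∪ farPoints Z d 0 1) ∪
  (nearPoints Z d 1 2 ∪ farPoints Z d 1 2) ∪
  (nearPoints Z d 2 0 ∪ farPoints Z d 2 0)

/-- The exceptional case: `S_{123}` is empty, `R_3` has an interior point, and
`R_{100}`, `R_{010}`, `R_{001}` are nonempty and connected (`IsConnected` includes
nonemptiness). -/
def Exceptional (Z : Fin 3 → Plane) (d : Fin 3 → ℝ) : Prop :=
  circleTriple Z d = ∅ ∧
  (interior (levelRegion Z d 3)).Nonempty ∧
  IsConnected (region Z d true false false) ∧
  IsConnected (region Z d false true false) ∧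
  IsConnected (region Z d false false true)

end SourceLocalization

end

/-! Let `C` be the radical center of the three circles and `p` its common power. At `C + Y` the
three powers are the image, under a linear isomorphism `L : ℝ × Plane ≃ ℝ³`, of the point `(‖Y‖² +
p, Y)` of a paraboloid. Minimizing `O` thus means minimizing the `ℓ¹` norm on `L` of a paraboloid,
and the sign of `p` says on which side of it the origin lies.

If `p ≥ 0`, the origin is not strictly above the paraboloid, and strict convexity gives a unique
minimizer (`minimizers_subsingleton`). If `p < 0`, the origin is strictly above; the largest `ℓ¹`
ball lying above the paraboloid is an octahedron, which by strict convexity touches it only at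
vertices (`minimizer_eq_zero_or`). At a vertex two powers vanish, hence the candidate points. Six
contacts are impossible (`encard_minimizers_le_five`).

Finally (E) is equivalent to `p < 0`. For `p < 0`, radial projection onto the paraboloid makes the
sole regions images of convex sets (`isConnected_soleSet`). For `p > 0`, inversion in the circle of
radius `√p` about `C` preserves each sole region, while under the rest of (E) the closure of one of
them misses that circle, so it is disconnected (`neg_of_exceptional`). The case `p = 0` is a common
point of the circles. -/

namespace SourceLocalization

/-! ### Linearizing the three circle equations -/

/-- The linear map `(s, Y) ↦ (s - 2⟪z i, Y⟫)ᵢ`, which sends `(‖Y‖² + p, Y)` to the values at `Y`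
of the circle equations `‖Y‖² - 2⟪z i, Y⟫ + p`. -/
noncomputable def pencilMap (z : Fin 3 → Plane) : (ℝ × Plane) →ₗ[ℝ] (Fin 3 → ℝ) where
  toFun x i := x.1 - 2 * inner ℝ (z i) x.2
  map_add' x y := by
    ext i
    simp only [Prod.fst_add, Prod.snd_add, inner_add_right, Pi.add_apply]
    ring
  map_smul' a x := by
    ext i
    simp only [Prod.smul_fst, Prod.smul_snd, inner_smul_right, smul_eq_mul, RingHom.id_apply,
      Pi.smul_apply]
    ring

theorem pencilMap_apply (z : Fin 3 → Plane) (x : ℝ × Plane) (i : Fin 3) :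
    pencilMap z x i = x.1 - 2 * inner ℝ (z i) x.2 := rfl

/-- In a kernel vector the plane component is orthogonal to all differences of the `z i`, and these
span the plane. -/
theorem pencilMap_injective {z : Fin 3 → Plane} (hz : AffineIndependent ℝ z) :
    Function.Injective (pencilMap z) := by
  rw [injective_iff_map_eq_zero]
  intro x hx
  have h (i : Fin 3) : x.1 = 2 * inner ℝ (z i) x.2 := by
    have := congrFun hx i
    rw [pencilMap_apply, Pi.zero_apply] at this
    linarith
  have htop : vectorSpan ℝ (Set.range z) = ⊤ :=
    hz.vectorSpan_eq_top_of_card_eq_finrank_add_one (by simp)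
  have hle : vectorSpan ℝ (Set.range z) ≤ (ℝ ∙ x.2)ᗮ := by
    rw [vectorSpan, Submodule.span_le]
    rintro _ ⟨_, ⟨i, rfl⟩, _, ⟨j, rfl⟩, rfl⟩
    simp only [SetLike.mem_coe, Submodule.mem_orthogonal_singleton_iff_inner_left, vsub_eq_sub,
      inner_sub_left]
    linarith [h i, h j]
  have h2 : x.2 = 0 := by
    have : x.2 ∈ (ℝ ∙ x.2)ᗮ := hle (htop ▸ Submodule.mem_top)
    rwa [Submodule.mem_orthogonal_singleton_iff_inner_left, inner_self_eq_zero] at this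
  have h1 : x.1 = 0 := by simpa [h2] using h 0
  exact Prod.ext h1 h2

/-- `pencilMap` as a linear equivalence, for non-collinear points. -/
noncomputable def pencilEquiv (z : Fin 3 → Plane) (hz : AffineIndependent ℝ z) :
    (ℝ × Plane) ≃ₗ[ℝ] (Fin 3 → ℝ) :=
  LinearEquiv.ofBijective (pencilMap z) ⟨pencilMap_injective hz,
    (LinearMap.injective_iff_surjective_of_finrank_eq_finrank (by simp)).1
      (pencilMap_injective hz)⟩

theorem pencilEquiv_apply (z : Fin 3 → Plane) (hz : AffineIndependent ℝ z) (x : ℝ × Plane)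
    (i : Fin 3) : pencilEquiv z hz x i = x.1 - 2 * inner ℝ (z i) x.2 := rfl

theorem pencilEquiv_one_zero (z : Fin 3 → Plane) (hz : AffineIndependent ℝ z) :
    pencilEquiv z hz (1, 0) = fun _ => 1 := by
  ext i
  simp [pencilEquiv_apply]

/-! ### The `ℓ¹` norm and its extreme points -/

/-- The `ℓ¹` norm on `ℝ³`. -/
def taxicab (u : Fin 3 → ℝ) : ℝ := ∑ i, |u i|

theorem taxicab_nonneg (u : Fin 3 → ℝ) : 0 ≤ taxicab u :=
  Finset.sum_nonneg fun _ _ => abs_nonneg _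

theorem taxicab_smul (a : ℝ) (u : Fin 3 → ℝ) : taxicab (a • u) = |a| * taxicab u := by
  simp [taxicab, abs_mul, Finset.mul_sum]

theorem taxicab_add_le (u v : Fin 3 → ℝ) : taxicab (u + v) ≤ taxicab u + taxicab v := by
  rw [taxicab, taxicab, taxicab, ← Finset.sum_add_distrib]
  exact Finset.sum_le_sum fun i _ => abs_add_le _ _

theorem taxicab_eq_zero {u : Fin 3 → ℝ} (h : taxicab u = 0) : u = 0 := by
  ext i
  have := (Finset.sum_eq_zero_iff_of_nonneg fun i _ => abs_nonneg (u i)).1 h i (Finset.mem_univ i)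
  simpa using this

theorem taxicab_single (i : Fin 3) (t : ℝ) : taxicab (Pi.single i t) = |t| := by
  rw [taxicab, Finset.sum_eq_single i]
  · simp
  · intro j _ hj
    simp [hj]
  · simp

/-- A vector with two nonzero entries is the midpoint of two distinct vectors of no larger
`ℓ¹` norm. -/
theorem exists_midpoint_of_ne_zero {u : Fin 3 → ℝ} {i j : Fin 3} (hij : i ≠ j) (hi : u i ≠ 0)
    (hj : u j ≠ 0) :
    ∃ δ : Fin 3 → ℝ, δ ≠ 0 ∧ taxicab (u + δ) ≤ taxicab u ∧ taxicab (u - δ) ≤ taxicab u := by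
  have hi' := abs_pos.2 hi
  have hj' := abs_pos.2 hj
  -- The perturbation is `u k * a k` with `|a k| ≤ 1`, so no sign changes and the norm is affine
  -- along it; `a` is balanced so that the change `∑ |u k| a k` is zero. The factor `ε` only ensures
  -- `|a k| ≤ 1`.
  set ε : ℝ := 1 / (|u i| + |u j|) with hε
  have hε0 : 0 < ε := by positivity
  have hεs : ε * |u i| + ε * |u j| = 1 := by
    rw [hε]
    field_simp
  have e1 : 0 < ε * |u i| := by positivity
  have e2 : 0 < ε * |u j| := by positivity
  let a : Fin 3 → ℝ := Pi.single i (ε * |u j|) - Pi.single j (ε * |u i|)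
  have ai : a i = ε * |u j| := by simp [a, hij]
  have aj : a j = -(ε * |u i|) := by simp [a, hij.symm]
  have ak (k : Fin 3) (h1 : k ≠ i) (h2 : k ≠ j) : a k = 0 := by simp [a, h1, h2]
  have ha (k : Fin 3) : |a k| ≤ 1 := by
    rw [abs_le]
    by_cases h1 : k = i
    · subst h1; rw [ai]; constructor <;> linarith
    by_cases h2 : k = j
    · subst h2; rw [aj]; constructor <;> linarith
    rw [ak k h1 h2]; norm_num
  have hs : ∑ k, |u k| * a k = 0 := by
    have : ∀ k, |u k| * a k
        = Pi.single (M := fun _ => ℝ) i (|u i| * (ε * |u j|)) k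
          - Pi.single (M := fun _ => ℝ) j (|u j| * (ε * |u i|)) k := by
      intro k
      by_cases h1 : k = i
      · subst h1; simp [ai, hij]
      by_cases h2 : k = j
      · subst h2; simp [aj, hij.symm]
      simp [ak k h1 h2, h1, h2]
    simp only [this, Finset.sum_sub_distrib, Finset.sum_pi_single', Finset.mem_univ, if_true]
    ring
  refine ⟨fun k => u k * a k, fun h => ?_, le_of_eq ?_, le_of_eq ?_⟩
  · have := congrFun h i
    simp only [ai, Pi.zero_apply] at this
    exact (mul_ne_zero hi e2.ne') this
  · have (k : Fin 3) : |(u + fun k => u k * a k) k| = |u k| + |u k| * a k := by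
      have h1 := abs_le.1 (ha k)
      rw [Pi.add_apply, ← mul_one_add, abs_mul, abs_of_nonneg (a := 1 + a k) (by linarith)]
      ring
    simp only [taxicab, this, Finset.sum_add_distrib, hs, add_zero]
  · have (k : Fin 3) : |(u - fun k => u k * a k) k| = |u k| - |u k| * a k := by
      have h1 := abs_le.1 (ha k)
      rw [Pi.sub_apply, ← mul_one_sub, abs_mul, abs_of_nonneg (a := 1 - a k) (by linarith)]
      ring
    simp only [taxicab, this, Finset.sum_sub_distrib, hs, sub_zero]

theorem exists_eq_single_of_eq_zero_or {u : Fin 3 → ℝ}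
    (h : ∀ i j, i ≠ j → u i = 0 ∨ u j = 0) : ∃ i t, u = Pi.single i t := by
  by_cases h0 : ∃ i, u i ≠ 0
  · obtain ⟨i, hi⟩ := h0
    refine ⟨i, u i, ?_⟩
    ext j
    by_cases hj : j = i
    · subst hj; simp
    · rw [Pi.single_eq_of_ne hj]
      exact (h j i hj).resolve_right hi
  · push Not at h0
    exact ⟨0, 0, by ext j; simp [h0 j]⟩

/-! ### Geometry of the paraboloid -/

/-- The height of `(s, Y)` above the paraboloid `s = ‖Y‖² + p`. -/
noncomputable def gap (p : ℝ) (x : ℝ × Plane) : ℝ := x.1 - p - ‖x.2‖ ^ 2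

/-- The point of the paraboloid `s = ‖Y‖² + p` over `Y`. -/
noncomputable def lift (p : ℝ) (Y : Plane) : ℝ × Plane := (‖Y‖ ^ 2 + p, Y)

theorem gap_lift (p : ℝ) (Y : Plane) : gap p (lift p Y) = 0 := by simp [gap, lift]

theorem lift_eq_of_gap {p : ℝ} {x : ℝ × Plane} (h : gap p x = 0) : lift p x.2 = x := by
  refine Prod.ext ?_ rfl
  simp only [gap] at h
  simp only [lift]
  linarith

theorem gap_smul (p t : ℝ) (x : ℝ × Plane) :
    gap p (t • x) = t * x.1 - p - t ^ 2 * ‖x.2‖ ^ 2 := by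
  simp [gap, norm_smul, mul_pow]

theorem continuous_gap_smul (p : ℝ) (x : ℝ × Plane) : Continuous fun t : ℝ => gap p (t • x) := by
  simp only [gap_smul]
  fun_prop

/-- Strict concavity in exact form, from the parallelogram law; the last term is what makes contacts
isolated. -/
theorem gap_midpoint (p : ℝ) (x y : ℝ × Plane) :
    gap p ((1 / 2 : ℝ) • (x + y)) = (gap p x + gap p y) / 2 + ‖x.2 - y.2‖ ^ 2 / 4 := by
  have h := parallelogram_law_with_norm ℝ x.2 y.2
  rw [gap_smul]
  simp only [gap, Prod.fst_add, Prod.snd_add]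
  nlinarith

/-- At the origin the gap is `-p ≤ 0`, so the segment from the origin to `x` crosses the paraboloid
before reaching `x`. -/
theorem exists_gap_smul_eq_zero_of_pos {p : ℝ} (hp : 0 ≤ p) {x : ℝ × Plane} (hx : 0 < gap p x) :
    ∃ t : ℝ, 0 ≤ t ∧ t < 1 ∧ gap p (t • x) = 0 := by
  have := intermediate_value_Icc (zero_le_one' ℝ) (continuous_gap_smul p x).continuousOn
  obtain ⟨t, ht, h⟩ := this (show (0 : ℝ) ∈ _ by
    constructor
    · simp [gap, hp]
    · simpa using hx.le)
  refine ⟨t, ht.1, lt_of_le_of_ne ht.2 ?_, h⟩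
  rintro rfl
  simp only [one_smul] at h
  exact hx.ne' h

theorem exists_gap_smul_eq_zero_of_neg {p : ℝ} (hp : p < 0) {x : ℝ × Plane} (hx : gap p x < 0) :
    ∃ t : ℝ, 0 ≤ t ∧ t < 1 ∧ gap p (t • x) = 0 := by
  have := intermediate_value_Icc' (zero_le_one' ℝ) (continuous_gap_smul p x).continuousOn
  obtain ⟨t, ht, h⟩ := this (show (0 : ℝ) ∈ _ by
    constructor
    · simpa using hx.le
    · simp [gap, hp.le])
  refine ⟨t, ht.1, lt_of_le_of_ne ht.2 ?_, h⟩
  rintro rfl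
  simp only [one_smul] at h
  exact hx.ne h

/-! ### Minimizers of the `ℓ¹` norm on the paraboloid -/

/-- The minimizers of the `ℓ¹` norm on the image of the paraboloid `s = ‖Y‖² + p` under `L`. -/
def minimizers (L : (ℝ × Plane) ≃ₗ[ℝ] (Fin 3 → ℝ)) (p : ℝ) : Set Plane :=
  {Y | ∀ V, taxicab (L (lift p Y)) ≤ taxicab (L (lift p V))}

section Minimizers

variable {L : (ℝ × Plane) ≃ₗ[ℝ] (Fin 3 → ℝ)} {p : ℝ}

theorem taxicab_le_smul {Y : Plane} (hY : Y ∈ minimizers L p) {x : ℝ × Plane} {t : ℝ}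
    (ht : 0 ≤ t) (h : gap p (t • x) = 0) : taxicab (L (lift p Y)) ≤ t * taxicab (L x) := by
  have := hY (t • x).2
  rwa [lift_eq_of_gap h, map_smul, taxicab_smul, abs_of_nonneg ht] at this

/-- The midpoint of two distinct minimizing lifts is strictly above the paraboloid and no larger in
norm; shrinking it back to the paraboloid contradicts minimality, unless the minimum is zero, where
injectivity of `L` applies. -/
theorem minimizers_subsingleton (hp : 0 ≤ p) : (minimizers L p).Subsingleton := by
  intro Y hY V hV
  by_contra hne
  have hm : taxicab (L (lift p Y)) = taxicab (L (lift p V)) := le_antisymm (hY V) (hV Y)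
  have hg : 0 < gap p ((1 / 2 : ℝ) • (lift p Y + lift p V)) := by
    rw [gap_midpoint, gap_lift, gap_lift]
    have : 0 < ‖Y - V‖ := norm_pos_iff.2 (sub_ne_zero.2 hne)
    simp only [lift]
    positivity
  obtain ⟨t, ht0, ht1, ht⟩ := exists_gap_smul_eq_zero_of_pos hp hg
  have h1 := taxicab_le_smul hY ht0 ht
  have h2 : taxicab (L ((1 / 2 : ℝ) • (lift p Y + lift p V))) ≤ taxicab (L (lift p Y)) := by
    rw [map_smul, taxicab_smul, map_add, abs_of_pos (by norm_num)]
    linarith [taxicab_add_le (L (lift p Y)) (L (lift p V))]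
  have h3 := taxicab_nonneg (L (lift p Y))
  have h4 : taxicab (L (lift p Y)) = 0 := by nlinarith
  have h5 : L (lift p Y) = L (lift p V) := by
    rw [taxicab_eq_zero h4, taxicab_eq_zero (hm.symm.trans h4)]
  exact hne (congrArg Prod.snd (L.injective h5))

theorem taxicab_pos (hp : p ≠ 0) (Y : Plane) : 0 < taxicab (L (lift p Y)) := by
  refine (taxicab_nonneg _).lt_of_ne fun h => ?_
  have h1 := (LinearEquiv.map_eq_zero_iff L).1 (taxicab_eq_zero h.symm)
  have h2 : Y = 0 := congrArg Prod.snd h1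
  have h3 : ‖Y‖ ^ 2 + p = 0 := congrArg Prod.fst h1
  simp [h2, hp] at h3

/-- The whole `ℓ¹` ball of minimal radius lies above the paraboloid: a point below could be shrunk
onto it, with smaller norm. -/
theorem gap_nonneg_of_taxicab_le (hp : p < 0) {Y : Plane} (hY : Y ∈ minimizers L p)
    {x : ℝ × Plane} (hx : taxicab (L x) ≤ taxicab (L (lift p Y))) : 0 ≤ gap p x := by
  by_contra! hg
  obtain ⟨t, ht0, ht1, ht⟩ := exists_gap_smul_eq_zero_of_neg hp hg
  have h1 := taxicab_le_smul hY ht0 ht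
  have h2 := taxicab_pos (L := L) hp.ne Y
  nlinarith

/-- Otherwise the contact point is the midpoint of two distinct points of the ball, both with
nonnegative gap, and strict concavity would make its own gap positive. -/
theorem minimizer_eq_zero_or (hp : p < 0) {Y : Plane} (hY : Y ∈ minimizers L p) {i j : Fin 3}
    (hij : i ≠ j) : L (lift p Y) i = 0 ∨ L (lift p Y) j = 0 := by
  by_contra! h
  obtain ⟨δ, hδ, h1, h2⟩ := exists_midpoint_of_ne_zero hij h.1 h.2
  rw [← L.apply_symm_apply δ, ← map_add] at h1
  rw [← L.apply_symm_apply δ, ← map_sub] at h2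
  have g1 := gap_nonneg_of_taxicab_le hp hY h1
  have g2 := gap_nonneg_of_taxicab_le hp hY h2
  set e := L.symm δ
  have hm : (1 / 2 : ℝ) • ((lift p Y + e) + (lift p Y - e)) = lift p Y := by
    rw [add_add_sub_cancel, ← two_smul ℝ, smul_smul]
    norm_num
  have h0 := gap_midpoint p (lift p Y + e) (lift p Y - e)
  rw [hm, gap_lift] at h0
  have hn : ‖(lift p Y + e).2 - (lift p Y - e).2‖ ^ 2 = 0 := by
    nlinarith [sq_nonneg ‖(lift p Y + e).2 - (lift p Y - e).2‖]
  have hg1 : gap p (lift p Y + e) = 0 := by nlinarith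
  have hg2 : gap p (lift p Y - e) = 0 := by nlinarith
  have hY2 : (lift p Y + e).2 = (lift p Y - e).2 := by
    rw [← sub_eq_zero, ← norm_eq_zero]
    exact pow_eq_zero_iff (two_ne_zero) |>.1 hn
  have he : lift p Y + e = lift p Y - e := by
    rw [← lift_eq_of_gap hg1, ← lift_eq_of_gap hg2, hY2]
  have he0 : e = 0 := by
    have : (2 : ℝ) • e = 0 := by
      rw [two_smul]
      calc e + e = (lift p Y + e) - (lift p Y - e) := by abel
        _ = 0 := by rw [he, sub_self]
    exact (smul_eq_zero.1 this).resolve_left two_ne_zero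
  exact hδ ((LinearEquiv.map_eq_zero_iff L.symm).1 he0)

/-- The vertices `± r eᵢ` of the octahedron of radius `r`. -/
def vertex (r : ℝ) (σ : Fin 3 × Bool) : Fin 3 → ℝ := Pi.single σ.1 (if σ.2 then r else -r)

theorem taxicab_vertex {r : ℝ} (hr : 0 < r) (σ : Fin 3 × Bool) : taxicab (vertex r σ) = r := by
  rw [vertex, taxicab_single]
  split_ifs
  · exact abs_of_pos hr
  · rw [abs_neg, abs_of_pos hr]

theorem exists_lift_eq_vertex (hp : p < 0) {Y : Plane} (hY : Y ∈ minimizers L p) :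
    ∃ σ, L (lift p Y) = vertex (taxicab (L (lift p Y))) σ := by
  obtain ⟨i, t, h⟩ := exists_eq_single_of_eq_zero_or (u := L (lift p Y)) fun i j hij =>
    minimizer_eq_zero_or hp hY hij
  rw [h, taxicab_single]
  rcases le_total 0 t with ht | ht
  · exact ⟨(i, true), by simp [vertex, abs_of_nonneg ht]⟩
  · exact ⟨(i, false), by simp [vertex, abs_of_nonpos ht]⟩

theorem vertex_injective {r : ℝ} (hr : 0 < r) : Function.Injective (vertex r) := by
  rintro ⟨i, a⟩ ⟨j, b⟩ h
  have h1 := congrFun h i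
  by_cases hij : i = j
  · subst hij
    cases a <;> cases b <;> simp [vertex] at h1 ⊢ <;> linarith
  · exfalso
    cases a <;> cases b <;> simp [vertex, hij] at h1 <;> linarith

/-- If the octahedron of radius `r` is inscribed in the region above the paraboloid, then the
minimizers correspond to the vertices lying on the paraboloid. -/
theorem encard_minimizers_eq (hp : p < 0) {r : ℝ} (hr : 0 < r)
    (hg : ∀ σ, 0 ≤ gap p (L.symm (vertex r σ))) (hz : ∃ σ, gap p (L.symm (vertex r σ)) = 0)
    (hne : (minimizers L p).Nonempty) :
    (minimizers L p).encard = {σ | gap p (L.symm (vertex r σ)) = 0}.encard := by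
  have hval {σ} (h : gap p (L.symm (vertex r σ)) = 0) :
      L (lift p (L.symm (vertex r σ)).2) = vertex r σ := by
    rw [lift_eq_of_gap h, L.apply_symm_apply]
  have hmin {Y} (hY : Y ∈ minimizers L p) : taxicab (L (lift p Y)) = r := by
    apply le_antisymm
    · obtain ⟨σ, hσ⟩ := hz
      have := hY (L.symm (vertex r σ)).2
      rwa [hval hσ, taxicab_vertex hr] at this
    · by_contra! hlt
      obtain ⟨σ, hσ⟩ := exists_lift_eq_vertex hp hY
      set m := taxicab (L (lift p Y))
      have hm : 0 < m := taxicab_pos hp.ne Y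
      have hs : lift p Y = (m / r) • L.symm (vertex r σ) := by
        rw [← map_smul, LinearEquiv.eq_symm_apply, hσ]
        have : (m / r) * r = m := by field_simp
        ext j
        simp only [vertex, Pi.smul_apply, smul_eq_mul]
        by_cases hj : j = σ.1
        · subst hj
          cases σ.2 <;> simp [this]
        · simp [hj]
      -- For `t = m / r` in `(0, 1)`, concavity gives `gap (t x) ≥ t gap x - (1 - t) p > 0`, so a
      -- shrunken vertex cannot lie on the paraboloid.
      have h0 := gap_lift p Y
      rw [hs, gap_smul] at h0
      have h1 := hg σ
      rw [gap] at h1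
      have ht0 : 0 < m / r := by positivity
      have ht1 : m / r < 1 := (div_lt_one hr).2 hlt
      have h2 := mul_nonneg ht0.le h1
      have h3 : 0 ≤ (m / r) * (1 - m / r) * ‖(L.symm (vertex r σ)).2‖ ^ 2 := by
        have : 0 ≤ 1 - m / r := by linarith
        positivity
      nlinarith
  have himg : minimizers L p
      = (fun σ => (L.symm (vertex r σ)).2) '' {σ | gap p (L.symm (vertex r σ)) = 0} := by
    ext Y
    constructor
    · intro hY
      obtain ⟨σ, hσ⟩ := exists_lift_eq_vertex hp hY
      rw [hmin hY] at hσ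
      have : L.symm (vertex r σ) = lift p Y := by rw [← hσ, L.symm_apply_apply]
      exact ⟨σ, by rw [Set.mem_ofPred_eq, this, gap_lift], by simp only [this, lift]⟩
    · rintro ⟨σ, hσ, rfl⟩ V
      obtain ⟨V', hV'⟩ := hne
      simp only [hval hσ]
      rw [taxicab_vertex hr, ← hmin hV']
      exact hV' V
  rw [himg, Set.InjOn.encard_image]
  intro σ hσ τ hτ h
  apply vertex_injective hr
  rw [← hval hσ, ← hval hτ]
  simp only at h
  rw [h]

theorem sum_fst_symm_single (hL : L (1, 0) = fun _ => 1) :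
    ∑ i, L.symm (Pi.single i 1) = (1, 0) := by
  rw [← map_sum, Finset.univ_sum_single (fun _ : Fin 3 => (1 : ℝ)), ← hL, L.symm_apply_apply]

/-- If both vertices `± r eᵢ` are on the paraboloid, subtracting the two equations shows that `L⁻¹
eᵢ` has first coordinate zero. This cannot hold for all `i`, since `∑ L⁻¹ eᵢ = (1, 0)`. -/
theorem encard_minimizers_le_five (hL : L (1, 0) = fun _ => 1) (hp : p < 0)
    (hne : (minimizers L p).Nonempty) : (minimizers L p).encard ≤ 5 := by
  obtain ⟨Y, hY⟩ := hne
  set r := taxicab (L (lift p Y)) with hrdef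
  have hr : 0 < r := taxicab_pos hp.ne Y
  have hg (σ) : 0 ≤ gap p (L.symm (vertex r σ)) := by
    apply gap_nonneg_of_taxicab_le hp hY
    rw [L.apply_symm_apply, taxicab_vertex hr]
  obtain ⟨τ, hτ⟩ := exists_lift_eq_vertex hp hY
  have hz : gap p (L.symm (vertex r τ)) = 0 := by rw [← hτ, L.symm_apply_apply, gap_lift]
  rw [encard_minimizers_eq hp hr hg ⟨τ, hz⟩ ⟨Y, hY⟩]
  have hex : ∃ σ, gap p (L.symm (vertex r σ)) ≠ 0 := by
    by_contra! hall
    have hb (i : Fin 3) : (L.symm (Pi.single i 1)).1 = 0 := by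
      have h1 := hall (i, true)
      have h2 := hall (i, false)
      have e1 : vertex r (i, true) = r • Pi.single i 1 := by
        rw [← Pi.single_smul]; simp [vertex]
      have e2 : vertex r (i, false) = (-r) • Pi.single i 1 := by
        rw [← Pi.single_smul]; simp [vertex]
      rw [e1, map_smul, gap_smul] at h1
      rw [e2, map_smul, gap_smul] at h2
      have : r * (L.symm (Pi.single i 1)).1 = 0 := by linarith
      exact (mul_eq_zero.1 this).resolve_left hr.ne'
    have := congrArg Prod.fst (sum_fst_symm_single hL)
    rw [Prod.fst_sum] at this
    simp [hb] at this
  obtain ⟨σ, hσ⟩ := hex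
  have hsub : {σ | gap p (L.symm (vertex r σ)) = 0} ⊆ ((Finset.univ.erase σ : Finset _) : Set _) := by
    intro ρ hρ
    simp only [Finset.coe_erase, Finset.coe_univ, Set.mem_sdiff, Set.mem_univ, true_and,
      Set.mem_singleton_iff]
    rintro rfl
    exact hσ hρ
  refine (Set.encard_le_encard hsub).trans ?_
  rw [Set.encard_coe_eq_coe_finsetCard, Finset.card_erase_of_mem (Finset.mem_univ _)]
  simp

end Minimizers

end SourceLocalization

/-! ### From circles to the paraboloid via the radical center -/

namespace SourceLocalization

/-- The values of the circle equations `‖W - Z i‖² - d i²`. -/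
noncomputable def power (Z : Fin 3 → Plane) (d : Fin 3 → ℝ) (W : Plane) (i : Fin 3) : ℝ :=
  ‖W - Z i‖ ^ 2 - d i ^ 2

theorem continuous_power (Z : Fin 3 → Plane) (d : Fin 3 → ℝ) (i : Fin 3) :
    Continuous fun W => power Z d W i := by
  unfold power
  fun_prop

theorem objective_sq_eq (Z : Fin 3 → Plane) (d : Fin 3 → ℝ) (W : Plane) :
    objective (fun y => y ^ 2) Z d W = taxicab (power Z d W) := rfl

theorem solutionSet_sq_nonempty (Z : Fin 3 → Plane) (d : Fin 3 → ℝ) :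
    (solutionSet (fun y => y ^ 2) Z d).Nonempty := by
  have hcont : Continuous (objective (fun y => y ^ 2) Z d) := by
    unfold objective
    fun_prop
  obtain ⟨W, hW⟩ := hcont.exists_forall_le (by
    have h1 : Filter.Tendsto (fun W => ‖W - Z 0‖) (Filter.cocompact Plane) Filter.atTop := by
      simpa only [dist_eq_norm] using tendsto_dist_right_cocompact_atTop (Z 0)
    have h2 : Filter.Tendsto (fun W => ‖W - Z 0‖ ^ 2 - d 0 ^ 2) (Filter.cocompact Plane)
        Filter.atTop :=
      Filter.tendsto_atTop_add_const_right _ _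
        ((Filter.tendsto_pow_atTop two_ne_zero).comp h1)
    refine Filter.tendsto_atTop_mono (fun W => ?_) h2
    exact (le_abs_self _).trans (Finset.single_le_sum
      (f := fun i => |‖W - Z i‖ ^ 2 - d i ^ 2|) (fun i _ => abs_nonneg _) (Finset.mem_univ 0)))
  exact ⟨W, hW⟩

theorem mem_disk_iff {Z : Fin 3 → Plane} {d : Fin 3 → ℝ} (hd : ∀ i, 0 ≤ d i) {W : Plane}
    {i : Fin 3} : W ∈ disk Z d i ↔ power Z d W i ≤ 0 := by
  rw [disk, Metric.mem_closedBall, dist_eq_norm, power, sub_nonpos,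
    sq_le_sq₀ (norm_nonneg _) (hd i)]

theorem mem_circle_iff {Z : Fin 3 → Plane} {d : Fin 3 → ℝ} (hd : ∀ i, 0 ≤ d i) {W : Plane}
    {i : Fin 3} : W ∈ circle Z d i ↔ power Z d W i = 0 := by
  rw [circle, mem_sphere_iff_norm, power, sub_eq_zero, sq_eq_sq₀ (norm_nonneg _) (hd i)]

theorem affineIndependent_sub {Z : Fin 3 → Plane} (hZ : AffineIndependent ℝ Z) (W : Plane) :
    AffineIndependent ℝ fun i => Z i - W := by
  have := hZ.map' (AffineEquiv.constVAdd ℝ Plane (-W)).toAffineMap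
    (AffineEquiv.constVAdd ℝ Plane (-W)).injective
  convert this using 2 with i
  simp [sub_eq_neg_add]

/-- The radical center `C` of the three circles, with common power `p`. -/
theorem exists_radicalCenter {Z : Fin 3 → Plane} (hZ : AffineIndependent ℝ Z) (d : Fin 3 → ℝ) :
    ∃ (C : Plane) (p : ℝ), ∀ Y i,
      power Z d (C + Y) i = ‖Y‖ ^ 2 + p - 2 * inner ℝ (Z i - C) Y := by
  obtain ⟨x, hx⟩ := (pencilEquiv Z hZ).surjective fun i => d i ^ 2 - ‖Z i‖ ^ 2
  -- The system `x.1 - 2⟪Z i, x.2⟫ = d i² - ‖Z i‖²` says that `x.2` has power `‖x.2‖² - x.1` for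
  -- every circle.
  refine ⟨x.2, ‖x.2‖ ^ 2 - x.1, fun Y i => ?_⟩
  have h := congrFun hx i
  rw [pencilEquiv_apply] at h
  have e : x.2 + Y - Z i = Y - (Z i - x.2) := by abel
  rw [power, e, norm_sub_sq_real, norm_sub_sq_real, real_inner_comm (Z i - x.2) Y]
  linarith

section RadicalCenter

variable {Z : Fin 3 → Plane} {d : Fin 3 → ℝ} {C : Plane} {p : ℝ}

/-- The equivalence `pencilEquiv` for the centers taken relative to `C`. -/
noncomputable def centeredEquiv (hZ : AffineIndependent ℝ Z) (C : Plane) :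
    (ℝ × Plane) ≃ₗ[ℝ] (Fin 3 → ℝ) :=
  pencilEquiv (fun i => Z i - C) (affineIndependent_sub hZ C)

theorem centeredEquiv_apply (hZ : AffineIndependent ℝ Z) (C : Plane) (x : ℝ × Plane) (i : Fin 3) :
    centeredEquiv hZ C x i = x.1 - 2 * inner ℝ (Z i - C) x.2 := rfl

theorem power_eq_centeredEquiv (hZ : AffineIndependent ℝ Z)
    (hC : ∀ Y i, power Z d (C + Y) i = ‖Y‖ ^ 2 + p - 2 * inner ℝ (Z i - C) Y) (Y : Plane) :
    power Z d (C + Y) = centeredEquiv hZ C (lift p Y) := by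
  ext i
  rw [hC, centeredEquiv_apply, lift]

theorem solutionSet_eq_image (hZ : AffineIndependent ℝ Z)
    (hC : ∀ Y i, power Z d (C + Y) i = ‖Y‖ ^ 2 + p - 2 * inner ℝ (Z i - C) Y) :
    solutionSet (fun y => y ^ 2) Z d = (C + ·) '' minimizers (centeredEquiv hZ C) p := by
  ext W
  constructor
  · intro hW
    refine ⟨W - C, fun V => ?_, by simp⟩
    have := hW (C + V)
    rw [objective_sq_eq, objective_sq_eq, power_eq_centeredEquiv hZ hC] at this
    rwa [← power_eq_centeredEquiv hZ hC, add_sub_cancel]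
  · rintro ⟨Y, hY, rfl⟩ V
    have := hY (V - C)
    rw [← power_eq_centeredEquiv hZ hC, ← power_eq_centeredEquiv hZ hC, add_sub_cancel] at this
    exact this

theorem encard_solutionSet_eq (hZ : AffineIndependent ℝ Z)
    (hC : ∀ Y i, power Z d (C + Y) i = ‖Y‖ ^ 2 + p - 2 * inner ℝ (Z i - C) Y) :
    (solutionSet (fun y => y ^ 2) Z d).encard = (minimizers (centeredEquiv hZ C) p).encard := by
  rw [solutionSet_eq_image hZ hC, (add_right_injective C).encard_image]

theorem minimizers_nonempty (hZ : AffineIndependent ℝ Z)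
    (hC : ∀ Y i, power Z d (C + Y) i = ‖Y‖ ^ 2 + p - 2 * inner ℝ (Z i - C) Y) :
    (minimizers (centeredEquiv hZ C) p).Nonempty := by
  have := solutionSet_sq_nonempty Z d
  rw [solutionSet_eq_image hZ hC] at this
  exact this.of_image

/-- A point neither nearest nor farthest would be a third common point of two circles with distinct
centers. -/
theorem mem_near_or_far {i j : Fin 3} (hZ : AffineIndependent ℝ Z) (hij : i ≠ j) {W : Plane}
    (hW : W ∈ circlePair Z d i j) : W ∈ nearPoints Z d i j ∪ farPoints Z d i j := by
  by_contra h
  simp only [nearPoints, farPoints, Set.mem_union, Set.mem_ofPred_eq, not_or, not_and, not_forall,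
    not_le, exists_prop] at h
  obtain ⟨V, hV, hVd⟩ := h.1 hW
  obtain ⟨V', hV', hVd'⟩ := h.2 hW
  have hfin : Module.finrank ℝ Plane = 2 := by simp
  rcases EuclideanGeometry.eq_of_dist_eq_of_dist_eq_of_finrank_eq_two (p₁ := V) (p₂ := V') (p := W)
    hfin (hZ.injective.ne hij) (fun e => (hVd.trans hVd').ne (by rw [e]))
    hV.1 hV'.1 hW.1 hV.2 hV'.2 hW.2 with e | e
  · exact hVd.ne (by rw [e])
  · exact hVd'.ne (by rw [e])

theorem solutionSet_subset_candidatePoints (hZ : AffineIndependent ℝ Z) (hd : ∀ i, 0 ≤ d i)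
    (hC : ∀ Y i, power Z d (C + Y) i = ‖Y‖ ^ 2 + p - 2 * inner ℝ (Z i - C) Y) (hp : p < 0) :
    solutionSet (fun y => y ^ 2) Z d ⊆ candidatePoints Z d := by
  rw [solutionSet_eq_image hZ hC]
  rintro _ ⟨Y, hY, rfl⟩
  have h (i j : Fin 3) (hij : i ≠ j) : power Z d (C + Y) i = 0 ∨ power Z d (C + Y) j = 0 := by
    rw [power_eq_centeredEquiv hZ hC]
    exact minimizer_eq_zero_or hp hY hij
  have hmem (i j : Fin 3) (hij : i ≠ j) (h1 : power Z d (C + Y) i = 0)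
      (h2 : power Z d (C + Y) j = 0) : C + Y ∈ nearPoints Z d i j ∪ farPoints Z d i j :=
    mem_near_or_far hZ hij ⟨(mem_circle_iff hd).2 h1, (mem_circle_iff hd).2 h2⟩
  have k1 := hmem 0 1 (by decide)
  have k2 := hmem 1 2 (by decide)
  have k3 := hmem 2 0 (by decide)
  have h1 := h 0 1 (by decide)
  have h2 := h 1 2 (by decide)
  have h3 := h 2 0 (by decide)
  rcases h1 with e0 | e1
  · rcases h2 with e1 | e2
    · exact Or.inl (Or.inl (k1 e0 e1))
    · exact Or.inr (k3 e2 e0)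
  · rcases h3 with e2 | e0
    · exact Or.inl (Or.inr (k2 e1 e2))
    · exact Or.inl (Or.inl (k1 e0 e1))

/-! ### Condition (E) in terms of powers -/

/-- The points lying in the `i`-th disk only. -/
def soleSet (Z : Fin 3 → Plane) (d : Fin 3 → ℝ) (i : Fin 3) : Set Plane :=
  {W | power Z d W i ≤ 0 ∧ ∀ j, j ≠ i → 0 < power Z d W j}

theorem exceptional_iff (hd : ∀ i, 0 ≤ d i) :
    Exceptional Z d ↔ circleTriple Z d = ∅ ∧ (interior (levelRegion Z d 3)).Nonempty ∧
      ∀ i, IsConnected (closure (soleSet Z d i)) := by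
  have h0 : region Z d true false false = closure (soleSet Z d 0) := by
    rw [region]
    congr 1
    ext W
    simp [side, mem_disk_iff hd, soleSet, Fin.forall_fin_succ, and_assoc]
  have h1 : region Z d false true false = closure (soleSet Z d 1) := by
    rw [region]
    congr 1
    ext W
    simp [side, mem_disk_iff hd, soleSet, Fin.forall_fin_succ, and_assoc, and_left_comm]
  have h2 : region Z d false false true = closure (soleSet Z d 2) := by
    rw [region]
    congr 1
    ext W
    simp [side, mem_disk_iff hd, soleSet, Fin.forall_fin_succ, and_comm (a := _ ∧ _)]
  rw [Exceptional, h0, h1, h2, Fin.forall_fin_succ, Fin.forall_fin_two]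
  rfl

theorem levelRegion_three : levelRegion Z d 3 = disk Z d 0 ∩ disk Z d 1 ∩ disk Z d 2 := by
  have hcl : IsClosed (disk Z d 0 ∩ disk Z d 1 ∩ disk Z d 2) :=
    (Metric.isClosed_closedBall.inter Metric.isClosed_closedBall).inter Metric.isClosed_closedBall
  have : region Z d true true true = disk Z d 0 ∩ disk Z d 1 ∩ disk Z d 2 := by
    simp only [region, side, if_true]
    exact hcl.closure_eq
  rw [← this]
  ext W
  simp only [levelRegion, Set.mem_ofPred_eq]
  constructor
  · rintro ⟨i, j, k, h, hW⟩
    cases i <;> cases j <;> cases k <;> simp at h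
    exact hW
  · exact fun hW => ⟨true, true, true, rfl, hW⟩

theorem interior_levelRegion_three :
    interior (levelRegion Z d 3) = {W | ∀ i, dist W (Z i) < d i} := by
  rw [levelRegion_three, interior_inter, interior_inter, disk, disk, disk, interior_closedBall',
    interior_closedBall', interior_closedBall']
  ext W
  simp [Fin.forall_fin_succ, and_assoc]

theorem dist_lt_iff (hd : ∀ i, 0 ≤ d i) {W : Plane} {i : Fin 3} :
    dist W (Z i) < d i ↔ power Z d W i < 0 := by
  rw [dist_eq_norm, power, sub_neg, sq_lt_sq₀ (norm_nonneg _) (hd i)]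

theorem power_center
    (hC : ∀ Y i, power Z d (C + Y) i = ‖Y‖ ^ 2 + p - 2 * inner ℝ (Z i - C) Y) (i : Fin 3) :
    power Z d C i = p := by
  simpa using hC 0 i

/-- A common point lifts to the origin, which is on the paraboloid only for `p = 0`; then `C` itself
is a common point. -/
theorem circleTriple_eq_empty_iff (hZ : AffineIndependent ℝ Z) (hd : ∀ i, 0 ≤ d i)
    (hC : ∀ Y i, power Z d (C + Y) i = ‖Y‖ ^ 2 + p - 2 * inner ℝ (Z i - C) Y) :
    circleTriple Z d = ∅ ↔ p ≠ 0 := by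
  rw [← not_iff_not, ← ne_eq, ← Set.nonempty_iff_ne_empty, not_not]
  constructor
  · rintro ⟨W, ⟨h0, h1⟩, h2⟩
    rw [mem_circle_iff hd] at h0 h1 h2
    have h : taxicab (power Z d (C + (W - C))) = 0 := by
      simp [taxicab, Fin.sum_univ_succ, h0, h1, h2]
    rw [power_eq_centeredEquiv hZ hC] at h
    by_contra hp
    exact (taxicab_pos hp (W - C)).ne' h
  · rintro rfl
    exact ⟨C, ⟨(mem_circle_iff hd).2 (power_center hC 0), (mem_circle_iff hd).2 (power_center hC 1)⟩,
      (mem_circle_iff hd).2 (power_center hC 2)⟩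

/-! ### The radical center inside all three circles -/

/-- The positive root `t` of `‖Y‖² t² - s t + p`, for `p < 0`. -/
noncomputable def scaleRoot (p : ℝ) (x : ℝ × Plane) : ℝ :=
  (x.1 + √(x.1 ^ 2 - 4 * p * ‖x.2‖ ^ 2)) / (2 * ‖x.2‖ ^ 2)

theorem scaleRoot_pos (hp : p < 0) {x : ℝ × Plane} (hx : x.2 ≠ 0) : 0 < scaleRoot p x := by
  have hn : 0 < ‖x.2‖ := norm_pos_iff.2 hx
  have h1 : |x.1| < √(x.1 ^ 2 - 4 * p * ‖x.2‖ ^ 2) := by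
    rw [← Real.sqrt_sq_eq_abs]
    apply Real.sqrt_lt_sqrt (sq_nonneg _)
    have : 0 < -p * ‖x.2‖ ^ 2 := mul_pos (by linarith) (by positivity)
    linarith
  have := neg_abs_le x.1
  exact div_pos (by linarith) (by positivity)

theorem gap_scaleRoot (hp : p < 0) {x : ℝ × Plane} (hx : x.2 ≠ 0) :
    gap p (scaleRoot p x • x) = 0 := by
  have hn : 0 < ‖x.2‖ := norm_pos_iff.2 hx
  have hs : √(x.1 ^ 2 - 4 * p * ‖x.2‖ ^ 2) ^ 2 = x.1 ^ 2 - 4 * p * ‖x.2‖ ^ 2 := by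
    apply Real.sq_sqrt
    have : 0 < -p * ‖x.2‖ ^ 2 := mul_pos (by linarith) (by positivity)
    nlinarith [sq_nonneg x.1]
  rw [gap_smul, scaleRoot]
  set S := √(x.1 ^ 2 - 4 * p * ‖x.2‖ ^ 2)
  field_simp
  nlinarith

theorem scaleRoot_lift (hp : p < 0) {Y : Plane} (hY : Y ≠ 0) : scaleRoot p (lift p Y) = 1 := by
  have hn : 0 < ‖Y‖ := norm_pos_iff.2 hY
  have : (‖Y‖ ^ 2 + p) ^ 2 - 4 * p * ‖Y‖ ^ 2 = (‖Y‖ ^ 2 - p) ^ 2 := by ring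
  simp only [scaleRoot, lift]
  rw [this, Real.sqrt_sq (by nlinarith)]
  field_simp
  ring

theorem continuousOn_scaleRoot : ContinuousOn (scaleRoot p) {x | x.2 ≠ 0} := by
  unfold scaleRoot
  refine ContinuousOn.div (by fun_prop) (by fun_prop) fun x hx => ?_
  have : 0 < ‖x.2‖ := norm_pos_iff.2 hx
  positivity

/-- The part of the octant structure of `ℝ³` corresponding to `soleSet`. -/
def soleOctant (i : Fin 3) : Set (Fin 3 → ℝ) := {u | u i ≤ 0 ∧ ∀ j, j ≠ i → 0 < u j}

theorem isConnected_soleOctant (i : Fin 3) : IsConnected (soleOctant i) := by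
  refine ⟨⟨fun j => if j = i then 0 else 1, by simp [soleOctant]; grind⟩, ?_⟩
  apply Convex.isPreconnected
  rintro u ⟨hu1, hu2⟩ v ⟨hv1, hv2⟩ a b ha hb hab
  refine ⟨?_, fun j hj => ?_⟩
  · simp only [Pi.add_apply, Pi.smul_apply, smul_eq_mul]
    nlinarith
  · simp only [Pi.add_apply, Pi.smul_apply, smul_eq_mul]
    have h1 := hu2 j hj
    have h2 := hv2 j hj
    rcases ha.eq_or_lt with rfl | ha
    · have : b = 1 := by linarith
      simp [this, h2]
    · have := mul_pos ha h1
      have := mul_nonneg hb h2.le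
      linarith

/-- The axis `Y = 0` maps to the diagonal of `ℝ³`, which misses the octant; hence `scaleRoot` is
continuous there. -/
theorem centeredEquiv_symm_snd_ne_zero (hZ : AffineIndependent ℝ Z) (C : Plane) {i : Fin 3}
    {u : Fin 3 → ℝ} (hu : u ∈ soleOctant i) : ((centeredEquiv hZ C).symm u).2 ≠ 0 := by
  intro h
  have hk (k : Fin 3) : u k = ((centeredEquiv hZ C).symm u).1 := by
    conv_lhs => rw [← (centeredEquiv hZ C).apply_symm_apply u]
    rw [centeredEquiv_apply, h]
    simp
  obtain ⟨j, hj⟩ : ∃ j : Fin 3, j ≠ i := exists_ne i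
  have := hu.2 j hj
  rw [hk, ← hk i] at this
  exact this.not_ge hu.1

/-- Positive scaling preserves the octant, so radial projection to the paraboloid maps this convex
set continuously onto the sole set. -/
theorem isConnected_soleSet (hZ : AffineIndependent ℝ Z)
    (hC : ∀ Y i, power Z d (C + Y) i = ‖Y‖ ^ 2 + p - 2 * inner ℝ (Z i - C) Y) (hp : p < 0)
    (i : Fin 3) : IsConnected (soleSet Z d i) := by
  set L := centeredEquiv hZ C with hLdef
  have himg : soleSet Z d i
      = (fun u => C + scaleRoot p (L.symm u) • (L.symm u).2) '' soleOctant i := by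
    ext W
    constructor
    · intro hW
      have hp' := power_eq_centeredEquiv hZ hC (W - C)
      rw [add_sub_cancel] at hp'
      have hu : power Z d W ∈ soleOctant i := hW
      refine ⟨power Z d W, hu, ?_⟩
      have hne := centeredEquiv_symm_snd_ne_zero hZ C hu
      have hs : L.symm (power Z d W) = lift p (W - C) := by rw [hp', L.symm_apply_apply]
      rw [← hLdef, hs] at hne
      have hne' : W - C ≠ 0 := hne
      simp only [hs]
      rw [scaleRoot_lift hp hne', lift, one_smul, add_sub_cancel]
    · rintro ⟨u, hu, rfl⟩
      have hne := centeredEquiv_symm_snd_ne_zero hZ C hu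
      rw [← hLdef] at hne
      have hpos := scaleRoot_pos hp hne
      have hval : power Z d (C + scaleRoot p (L.symm u) • (L.symm u).2)
          = scaleRoot p (L.symm u) • u := by
        have := lift_eq_of_gap (gap_scaleRoot hp hne)
        rw [Prod.smul_snd] at this
        rw [power_eq_centeredEquiv hZ hC, this, map_smul, ← hLdef, L.apply_symm_apply]
      simp only [soleSet, Set.mem_ofPred_eq, hval, Pi.smul_apply, smul_eq_mul]
      exact ⟨mul_nonpos_of_nonneg_of_nonpos hpos.le hu.1, fun j hj => mul_pos hpos (hu.2 j hj)⟩
  rw [himg]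
  apply (isConnected_soleOctant i).image
  have hLc : Continuous L.symm := L.symm.toLinearMap.continuous_of_finiteDimensional
  have h1 : ContinuousOn (fun u => scaleRoot p (L.symm u)) (soleOctant i) :=
    continuousOn_scaleRoot.comp hLc.continuousOn fun u hu =>
      centeredEquiv_symm_snd_ne_zero hZ C hu
  exact continuousOn_const.add (h1.smul hLc.snd.continuousOn)

theorem exceptional_of_neg (hZ : AffineIndependent ℝ Z) (hd : ∀ i, 0 ≤ d i)
    (hC : ∀ Y i, power Z d (C + Y) i = ‖Y‖ ^ 2 + p - 2 * inner ℝ (Z i - C) Y) (hp : p < 0) :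
    Exceptional Z d := by
  refine (exceptional_iff hd).2 ⟨(circleTriple_eq_empty_iff hZ hd hC).2 hp.ne, ⟨C, ?_⟩,
    fun i => (isConnected_soleSet hZ hC hp i).closure⟩
  rw [interior_levelRegion_three]
  intro i
  rw [dist_lt_iff hd, power_center hC]
  exact hp

end RadicalCenter
end SourceLocalization

namespace SourceLocalization

/-! ### The radical center outside all three circles -/

/-- Affine functionals that are nonnegative on given test vectors `A` and `B k`. -/
def dualSet (A : Fin 3 → ℝ) (B : Fin 3 → Fin 3 → ℝ) : Set (Fin 3 → ℝ) :=
  {α | ∑ i, α i = 1 ∧ 0 ≤ ∑ i, α i * A i ∧ ∀ k, 0 ≤ ∑ i, α i * B k i}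

section DualSet

variable {A : Fin 3 → ℝ} {B : Fin 3 → Fin 3 → ℝ} {α β : Fin 3 → ℝ}

theorem dualSet_convex : Convex ℝ (dualSet A B) := by
  rintro α ⟨h1, h2, h3⟩ β ⟨k1, k2, k3⟩ a b ha hb hab
  have hsum (f : Fin 3 → ℝ) :
      ∑ i, (a • α + b • β) i * f i = a * ∑ i, α i * f i + b * ∑ i, β i * f i := by
    simp only [Pi.add_apply, Pi.smul_apply, smul_eq_mul, add_mul, Finset.sum_add_distrib,
      Finset.mul_sum, mul_assoc]
  refine ⟨?_, ?_, fun k => ?_⟩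
  · have := hsum fun _ => 1
    simp only [mul_one, h1, k1] at this
    rw [this, hab]
  · rw [hsum]
    positivity
  · rw [hsum]
    have := h3 k
    have := k3 k
    positivity

theorem exists_third (i j : Fin 3) (hij : i ≠ j) :
    ∃ k, k ≠ i ∧ k ≠ j ∧ ∀ f : Fin 3 → ℝ, ∑ l, f l = f i + f j + f k := by
  have : ∃ k, k ≠ i ∧ k ≠ j ∧ Finset.univ = {i, j, k} := by
    revert i j
    decide
  obtain ⟨k, hi, hj, h⟩ := this
  refine ⟨k, hi, hj, fun f => ?_⟩
  rw [h, Finset.sum_insert (by simp [hij, hi.symm]), Finset.sum_pair hj.symm, add_assoc]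

/-- If both were nonpositive, testing against `B k` for the third index `k` would force both to
vanish, and testing against `A` would then fail. -/
theorem dualSet_pos_or_pos (hA : ∀ i, A i < 0) (hB : ∀ i, B i i ≤ 0 ∧ ∀ j, j ≠ i → 0 < B i j)
    (hα : α ∈ dualSet A B) {i j : Fin 3} (hij : i ≠ j) : 0 < α i ∨ 0 < α j := by
  by_contra! h
  obtain ⟨h1, h2, h3⟩ := hα
  obtain ⟨k, hki, hkj, hs⟩ := exists_third i j hij
  replace h3 := h3 k
  rw [hs] at h1 h2 h3
  have b1 := (hB k).1
  have b2 := (hB k).2 i hki.symm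
  have b3 := (hB k).2 j hkj.symm
  have hk : 0 < α k := by linarith
  have c1 : α k * B k k ≤ 0 := mul_nonpos_of_nonneg_of_nonpos hk.le b1
  have c2 : α i * B k i ≤ 0 := mul_nonpos_of_nonpos_of_nonneg h.1 b2.le
  have c3 : α j * B k j ≤ 0 := mul_nonpos_of_nonpos_of_nonneg h.2 b3.le
  have d2 : α i = 0 := (mul_eq_zero.1 (by linarith : α i * B k i = 0)).resolve_right b2.ne'
  have d3 : α j = 0 := (mul_eq_zero.1 (by linarith : α j * B k j = 0)).resolve_right b3.ne'
  rw [d2, d3] at h2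
  have := mul_neg_of_pos_of_neg hk (hA k)
  linarith

theorem dualSet_exists_neg (hA : ∀ i, A i < 0) (hα : α ∈ dualSet A B) : ∃ i, α i < 0 := by
  by_contra! h
  obtain ⟨h1, h2, -⟩ := hα
  have h3 (i : Fin 3) : α i * A i ≤ 0 := mul_nonpos_of_nonneg_of_nonpos (h i) (hA i).le
  have h4 := (Finset.sum_eq_zero_iff_of_nonpos fun i _ => h3 i).1
    (le_antisymm (Finset.sum_nonpos fun i _ => h3 i) h2)
  have h5 (i : Fin 3) : α i = 0 := (mul_eq_zero.1 (h4 i (Finset.mem_univ i))).resolve_right (hA i).ne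
  simp [h5] at h1

theorem dualSet_ne_zero (hA : ∀ i, A i < 0) (hB : ∀ i, B i i ≤ 0 ∧ ∀ j, j ≠ i → 0 < B i j)
    (hα : α ∈ dualSet A B) (i : Fin 3) : α i ≠ 0 := by
  intro h
  obtain ⟨j, hj⟩ := dualSet_exists_neg hA hα
  have hij : i ≠ j := by
    rintro rfl
    exact hj.ne h
  exact (dualSet_pos_or_pos hA hB hα hij).elim h.not_gt hj.not_gt

/-- By convexity, a sign change in coordinate `i` would produce a member whose `i`-th coordinate is
zero. -/
theorem dualSet_neg_of_neg (hA : ∀ i, A i < 0) (hB : ∀ i, B i i ≤ 0 ∧ ∀ j, j ≠ i → 0 < B i j)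
    (hα : α ∈ dualSet A B) (hβ : β ∈ dualSet A B) {i : Fin 3} (hi : α i < 0) : β i < 0 := by
  by_contra! h
  have hpos : 0 < β i - α i := by linarith
  have hmem := dualSet_convex hα hβ (a := β i / (β i - α i)) (b := -α i / (β i - α i))
    (by positivity) (div_nonneg (by linarith) hpos.le) (by field_simp; ring)
  apply dualSet_ne_zero hA hB hmem i
  simp only [Pi.add_apply, Pi.smul_apply, smul_eq_mul]
  field_simp
  ring

end DualSet

/-! ### Barycentric coordinates, inversion, and excluding `p > 0` -/

section RadicalCenter

variable {Z : Fin 3 → Plane} {d : Fin 3 → ℝ} {C : Plane} {p : ℝ}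

/-- Barycentric coordinates, with respect to the centers, of the point `C + Y`. -/
noncomputable def barycentric (hZ : AffineIndependent ℝ Z) (C Y : Plane) (k : Fin 3) : ℝ :=
  ((centeredEquiv hZ C).symm (Pi.single k 1)).1
    - 2 * inner ℝ Y ((centeredEquiv hZ C).symm (Pi.single k 1)).2

theorem sum_barycentric_mul (hZ : AffineIndependent ℝ Z) (Y : Plane) (x : ℝ × Plane) :
    ∑ k, barycentric hZ C Y k * centeredEquiv hZ C x k = x.1 - 2 * inner ℝ Y x.2 := by
  set L := centeredEquiv hZ C with hL
  have hx : x = ∑ k, L x k • L.symm (Pi.single k 1) := by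
    simp only [← map_smul, ← map_sum]
    rw [LinearEquiv.eq_symm_apply]
    ext j
    simp [Pi.single_apply]
  have h1 : x.1 = ∑ k, L x k * (L.symm (Pi.single k 1)).1 := by
    conv_lhs => rw [hx]
    simp [Prod.fst_sum]
  have h2 : x.2 = ∑ k, L x k • (L.symm (Pi.single k 1)).2 := by
    conv_lhs => rw [hx]
    simp [Prod.snd_sum]
  conv_rhs => rw [h1, h2]
  rw [inner_sum, Finset.mul_sum, ← Finset.sum_sub_distrib]
  refine Finset.sum_congr rfl fun k _ => ?_
  rw [inner_smul_right, barycentric, ← hL]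
  ring

theorem sum_barycentric (hZ : AffineIndependent ℝ Z) (Y : Plane) :
    ∑ k, barycentric hZ C Y k = 1 := by
  have := sum_barycentric_mul (C := C) hZ Y (1, 0)
  rw [centeredEquiv, pencilEquiv_one_zero] at this
  simpa using this

/-- For `‖Y‖² = p` the tangent plane of the paraboloid over `Y` passes through the origin, so it is
the kernel of a linear functional whose value at a lift is a squared distance. -/
theorem sum_barycentric_mul_power (hZ : AffineIndependent ℝ Z)
    (hC : ∀ Y i, power Z d (C + Y) i = ‖Y‖ ^ 2 + p - 2 * inner ℝ (Z i - C) Y) {Y : Plane}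
    (hY : ‖Y‖ ^ 2 = p) (W : Plane) :
    ∑ k, barycentric hZ C Y k * power Z d W k = ‖Y - (W - C)‖ ^ 2 := by
  have h := sum_barycentric_mul (C := C) hZ Y (lift p (W - C))
  rw [← power_eq_centeredEquiv hZ hC, add_sub_cancel] at h
  rw [h, norm_sub_sq_real, hY, lift]
  ring

theorem power_inversion
    (hC : ∀ Y i, power Z d (C + Y) i = ‖Y‖ ^ 2 + p - 2 * inner ℝ (Z i - C) Y) {Y : Plane}
    (hY : Y ≠ 0) (i : Fin 3) :
    power Z d (C + (p / ‖Y‖ ^ 2) • Y) i = p / ‖Y‖ ^ 2 * power Z d (C + Y) i := by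
  have hn : 0 < ‖Y‖ := norm_pos_iff.2 hY
  rw [hC, hC, norm_smul, inner_smul_right, mul_pow, Real.norm_eq_abs, sq_abs]
  field_simp
  ring

theorem norm_sq_inversion {Y : Plane} (hY : Y ≠ 0) :
    ‖(p / ‖Y‖ ^ 2) • Y‖ ^ 2 * ‖Y‖ ^ 2 = p ^ 2 := by
  have hn : 0 < ‖Y‖ := norm_pos_iff.2 hY
  rw [norm_smul, mul_pow, Real.norm_eq_abs, sq_abs]
  field_simp

theorem neg_of_exceptional (hZ : AffineIndependent ℝ Z) (hd : ∀ i, 0 ≤ d i)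
    (hC : ∀ Y i, power Z d (C + Y) i = ‖Y‖ ^ 2 + p - 2 * inner ℝ (Z i - C) Y)
    (hE : Exceptional Z d) : p < 0 := by
  obtain ⟨hS, ⟨A, hA⟩, hR⟩ := (exceptional_iff hd).1 hE
  by_contra! hp0
  have hp : 0 < p := hp0.lt_of_ne' ((circleTriple_eq_empty_iff hZ hd hC).1 hS)
  rw [interior_levelRegion_three] at hA
  replace hA (i : Fin 3) : power Z d A i < 0 := (dist_lt_iff hd).1 (hA i)
  have hBex (i : Fin 3) : (soleSet Z d i).Nonempty := closure_nonempty_iff.1 (hR i).1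
  choose B hB using hBex
  have hdual {Y : Plane} (hY : ‖Y‖ ^ 2 = p) :
      barycentric hZ C Y ∈ dualSet (power Z d A) (fun k => power Z d (B k)) := by
    refine ⟨sum_barycentric hZ Y, ?_, fun k => ?_⟩
    · rw [sum_barycentric_mul_power hZ hC hY]
      positivity
    · rw [sum_barycentric_mul_power hZ hC hY]
      positivity
  obtain ⟨Y₀, hY₀⟩ : ∃ Y : Plane, ‖Y‖ ^ 2 = p := by
    obtain ⟨Y, hY⟩ := exists_norm_eq Plane (Real.sqrt_nonneg p)
    exact ⟨Y, by rw [hY, Real.sq_sqrt hp.le]⟩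
  -- By `dualSet_neg_of_neg` this index serves for every point of the circle `‖Y‖² = p`, not just
  -- `Y₀`.
  obtain ⟨i, hi⟩ := dualSet_exists_neg hA (hdual hY₀)
  have hsep (W : Plane) (hW : W ∈ closure (soleSet Z d i)) : ‖W - C‖ ^ 2 ≠ p := by
    intro hWp
    have hclosed : IsClosed {W | power Z d W i ≤ 0 ∧ ∀ j, j ≠ i → 0 ≤ power Z d W j} := by
      simp only [Set.ofPred_and, Set.ofPred_forall]
      refine (isClosed_le (continuous_power Z d i) continuous_const).inter ?_
      exact isClosed_iInter fun j => isClosed_iInter fun _ =>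
        isClosed_le continuous_const (continuous_power Z d j)
    have hsub : soleSet Z d i ⊆ {W | power Z d W i ≤ 0 ∧ ∀ j, j ≠ i → 0 ≤ power Z d W j} :=
      fun V hV => ⟨hV.1, fun j hj => (hV.2 j hj).le⟩
    have hW' := closure_minimal hsub hclosed hW
    have hα := hdual hWp
    have hαi := dualSet_neg_of_neg hA hB (hdual hY₀) hα hi
    -- Taking `W` itself as the point of the circle makes the sum zero while each term is
    -- nonnegative, so all three powers vanish at `W`.
    have hs := sum_barycentric_mul_power hZ hC hWp W
    rw [sub_self, norm_zero, zero_pow two_ne_zero] at hs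
    have hnn (k : Fin 3) : 0 ≤ barycentric hZ C (W - C) k * power Z d W k := by
      by_cases hk : k = i
      · subst hk
        exact mul_nonneg_of_nonpos_of_nonpos hαi.le hW'.1
      · have := (dualSet_pos_or_pos hA hB hα hk).resolve_right hαi.not_gt
        exact mul_nonneg this.le (hW'.2 k hk)
    have hz := (Finset.sum_eq_zero_iff_of_nonneg fun k _ => hnn k).1 hs
    have hzero (k : Fin 3) : W ∈ circle Z d k :=
      (mem_circle_iff hd).2 ((mul_eq_zero.1 (hz k (Finset.mem_univ k))).resolve_left
        (dualSet_ne_zero hA hB hα k))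
    have : W ∈ circleTriple Z d := ⟨⟨hzero 0, hzero 1⟩, hzero 2⟩
    rw [hS] at this
    exact this
  set Y := B i - C with hYdef
  have hBY : C + Y = B i := by rw [hYdef, add_sub_cancel]
  have hY0 : Y ≠ 0 := by
    intro h
    have h1 := (hB i).1
    rw [← hBY, h, add_zero, power_center hC] at h1
    exact hp.not_ge h1
  have hn : 0 < ‖Y‖ := norm_pos_iff.2 hY0
  have hq : 0 < p / ‖Y‖ ^ 2 := by positivity
  have hB' : C + (p / ‖Y‖ ^ 2) • Y ∈ soleSet Z d i := by
    refine ⟨?_, fun j hj => ?_⟩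
    · rw [power_inversion hC hY0, hBY]
      exact mul_nonpos_of_nonneg_of_nonpos hq.le (hB i).1
    · rw [power_inversion hC hY0, hBY]
      exact mul_pos hq ((hB i).2 j hj)
  have hinv := norm_sq_inversion (p := p) hY0
  have hcont : ContinuousOn (fun W => ‖W - C‖ ^ 2) (closure (soleSet Z d i)) := by fun_prop
  have hpre := (hR i).isPreconnected
  have m1 := subset_closure (hB i)
  have m2 := subset_closure hB'
  have e1 : ‖B i - C‖ ^ 2 = ‖Y‖ ^ 2 := rfl
  have e2 : ‖C + (p / ‖Y‖ ^ 2) • Y - C‖ ^ 2 = ‖(p / ‖Y‖ ^ 2) • Y‖ ^ 2 := by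
    rw [add_sub_cancel_left]
  have hY2 : 0 < ‖Y‖ ^ 2 := by positivity
  -- `B i` and its inverse lie on opposite sides of the circle, so connectedness forces a crossing.
  rcases le_total (‖Y‖ ^ 2) p with h | h
  · obtain ⟨W, hW, hWp⟩ := hpre.intermediate_value m1 m2 hcont (show p ∈ _ from by
      constructor
      · exact h
      · simp only [e2]
        nlinarith)
    exact hsep W hW hWp
  · obtain ⟨W, hW, hWp⟩ := hpre.intermediate_value m2 m1 hcont (show p ∈ _ from by
      constructor
      · simp only [e2]
        by_contra! hlt
        nlinarith
      · exact h)
    exact hsep W hW hWp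

end RadicalCenter

/-! ### Configurations with a prescribed number of minimizers -/

/-- An isosceles triangle of sensors. -/
noncomputable def isosceles (b : ℝ) : Fin 3 → Plane :=
  ![!₂[1 / 2, b], !₂[-1 / 2, b], !₂[0, b - 1]]

theorem affineIndependent_isosceles (b : ℝ) : AffineIndependent ℝ (isosceles b) := by
  rw [affineIndependent_iff_of_fintype]
  intro w hw h
  rw [Finset.weightedVSub_eq_linear_combination _ hw] at h
  have h0 := congrArg (fun v : Plane => v 0) h
  have h1 := congrArg (fun v : Plane => v 1) h
  simp [isosceles, Fin.sum_univ_three] at h0 h1 hw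
  have a2 : w 2 = 0 := by linear_combination b * hw - h1
  have a0 : w 0 = 0 := by linarith
  have a1 : w 1 = 0 := by linarith
  intro i
  fin_cases i
  exacts [a0, a1, a2]

/-- The value of `gap` at the octahedron vertices, for the sensors `isosceles b`. -/
noncomputable def isoscelesGap (b c r : ℝ) (σ : Fin 3 × Bool) : ℝ :=
  (if σ.2 then r else -r) * ![(1 - b) / 2, (1 - b) / 2, b] σ.1 + c
    - r ^ 2 * ![5 / 16, 5 / 16, 1 / 4] σ.1

theorem gap_symm_vertex_isosceles (b c r : ℝ) (σ : Fin 3 × Bool) :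
    gap (-c) ((centeredEquiv (affineIndependent_isosceles b) 0).symm (vertex r σ))
      = isoscelesGap b c r σ := by
  set L := centeredEquiv (affineIndependent_isosceles b) 0 with hL
  have hsymm (i : Fin 3) : L.symm (Pi.single i 1) = (![(1 - b) / 2, (1 - b) / 2, b] i,
      ![!₂[-1 / 2, -1 / 4], !₂[1 / 2, -1 / 4], !₂[0, 1 / 2]] i) := by
    rw [LinearEquiv.symm_apply_eq]
    ext j
    rw [hL, centeredEquiv_apply]
    fin_cases i <;> fin_cases j <;>
      simp [isosceles, EuclideanSpace.inner_eq_star_dotProduct, dotProduct, Fin.sum_univ_two] <;>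
      ring
  obtain ⟨i, s⟩ := σ
  have hv : vertex r (i, s) = (if s then r else -r) • Pi.single i 1 := by
    rw [← Pi.single_smul]
    simp [vertex]
  have hsq : (if s then r else -r) ^ 2 = r ^ 2 := by cases s <;> simp
  rw [hv, map_smul, hsymm, gap_smul, isoscelesGap, hsq]
  have hnorm : ‖(![!₂[-1 / 2, -1 / 4], !₂[1 / 2, -1 / 4], !₂[0, 1 / 2]] i : Plane)‖ ^ 2
      = ![5 / 16, 5 / 16, 1 / 4] i := by
    fin_cases i <;> simp [EuclideanSpace.norm_sq_eq, Fin.sum_univ_two] <;> norm_num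
  simp only [hnorm]
  ring

theorem exists_encard_solutionSet_eq {b c r : ℝ} (hc : 0 < c) (hr : 0 < r)
    (hg : ∀ σ, 0 ≤ isoscelesGap b c r σ) (hz : ∃ σ, isoscelesGap b c r σ = 0) :
    ∃ (Z : Fin 3 → Plane) (d : Fin 3 → ℝ), AffineIndependent ℝ Z ∧ (∀ i, 0 ≤ d i) ∧
      (solutionSet (fun y => y ^ 2) Z d).encard = {σ | isoscelesGap b c r σ = 0}.encard := by
  have hZ := affineIndependent_isosceles b
  -- These radii put the radical center at the origin, with power `-c`.
  let d : Fin 3 → ℝ := fun i => √(‖isosceles b i‖ ^ 2 + c)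
  have hC (Y : Plane) (i : Fin 3) : power (isosceles b) d (0 + Y) i
      = ‖Y‖ ^ 2 + -c - 2 * inner ℝ (isosceles b i - 0) Y := by
    rw [power, zero_add, sub_zero, norm_sub_sq_real, Real.sq_sqrt (by positivity), real_inner_comm]
    ring
  refine ⟨isosceles b, d, hZ, fun i => Real.sqrt_nonneg _, ?_⟩
  simp only [← gap_symm_vertex_isosceles] at hg hz ⊢
  rw [encard_solutionSet_eq hZ hC]
  exact encard_minimizers_eq (by linarith) hr hg hz (minimizers_nonempty hZ hC)

theorem exists_encard_solutionSet_eq_card {b c r : ℝ} (hc : 0 < c) (hr : 0 < r)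
    (s : Finset (Fin 3 × Bool)) (hs : s.Nonempty) (h0 : ∀ σ ∈ s, isoscelesGap b c r σ = 0)
    (h1 : ∀ σ ∉ s, 0 < isoscelesGap b c r σ) :
    ∃ (Z : Fin 3 → Plane) (d : Fin 3 → ℝ), AffineIndependent ℝ Z ∧ (∀ i, 0 ≤ d i) ∧
      (solutionSet (fun y => y ^ 2) Z d).encard = s.card := by
  obtain ⟨σ, hσ⟩ := hs
  obtain ⟨Z, d, hZ, hd, h⟩ := exists_encard_solutionSet_eq hc hr (b := b) (fun τ => by
    by_cases hτ : τ ∈ s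
    · exact (h0 τ hτ).ge
    · exact (h1 τ hτ).le) ⟨σ, h0 σ hσ⟩
  refine ⟨Z, d, hZ, hd, ?_⟩
  rw [h, ← Set.encard_coe_eq_coe_finsetCard]
  congr 1
  ext τ
  exact ⟨fun hτ => by_contra fun hn => (h1 τ hn).ne' hτ, h0 τ⟩

theorem exists_encard_solutionSet_eq_natCast (m : ℕ) (h1 : 1 ≤ m) (h5 : m ≤ 5) :
    ∃ (Z : Fin 3 → Plane) (d : Fin 3 → ℝ), AffineIndependent ℝ Z ∧ (∀ i, 0 ≤ d i) ∧
      (solutionSet (fun y => y ^ 2) Z d).encard = m := by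
  -- For `b = 1/2` the vertices `-r e₀`, `-r e₁` touch first when `r > 4`, `-r e₂` when `r < 4`, all
  -- three when `r = 4`. For `b = 1` the first coordinates of `L⁻¹ e₀`, `L⁻¹ e₁` vanish, so `± r
  -- e₀`, `± r e₁` touch together once `c = 5r²/16`; `-r e₂` joins them exactly at `r = 16`.
  interval_cases m
  · refine exists_encard_solutionSet_eq_card (b := 1 / 2) (c := 2) (r := 2) (by norm_num)
      (by norm_num) {(2, false)} (by simp) ?_ ?_ <;>
    · rintro ⟨i, s⟩ h
      fin_cases i <;> cases s <;> simp [isoscelesGap] at h ⊢ <;> norm_num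
  · refine exists_encard_solutionSet_eq_card (b := 1 / 2) (c := 22) (r := 8) (by norm_num)
      (by norm_num) {(0, false), (1, false)} (by simp) ?_ ?_ <;>
    · rintro ⟨i, s⟩ h
      fin_cases i <;> cases s <;> simp [isoscelesGap] at h ⊢ <;> norm_num
  · refine exists_encard_solutionSet_eq_card (b := 1 / 2) (c := 6) (r := 4) (by norm_num)
      (by norm_num) {(0, false), (1, false), (2, false)} (by simp) ?_ ?_ <;>
    · rintro ⟨i, s⟩ h
      fin_cases i <;> cases s <;> simp [isoscelesGap] at h ⊢ <;> norm_num
  · refine exists_encard_solutionSet_eq_card (b := 1) (c := 320) (r := 32) (by norm_num)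
      (by norm_num) {(0, false), (0, true), (1, false), (1, true)} (by simp) ?_ ?_ <;>
    · rintro ⟨i, s⟩ h
      fin_cases i <;> cases s <;> simp [isoscelesGap] at h ⊢ <;> norm_num
  · refine exists_encard_solutionSet_eq_card (b := 1) (c := 80) (r := 16) (by norm_num)
      (by norm_num) {(0, false), (0, true), (1, false), (1, true), (2, false)} (by simp) ?_ ?_ <;>
    · rintro ⟨i, s⟩ h
      fin_cases i <;> cases s <;> simp [isoscelesGap] at h ⊢ <;> norm_num

end SourceLocalization

theorem mainTheorem9 :
    (∀ (Z : Fin 3 → SourceLocalization.Plane) (d : Fin 3 → ℝ),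
      AffineIndependent ℝ Z → (∀ i, 0 ≤ d i) →
        (SourceLocalization.Exceptional Z d →
          SourceLocalization.solutionSet (fun y => y ^ 2) Z d ⊆
              SourceLocalization.candidatePoints Z d ∧
            1 ≤ (SourceLocalization.solutionSet (fun y => y ^ 2) Z d).encard ∧
            (SourceLocalization.solutionSet (fun y => y ^ 2) Z d).encard ≤ 5) ∧
        (¬ SourceLocalization.Exceptional Z d →
          (SourceLocalization.solutionSet (fun y => y ^ 2) Z d).encard = 1)) ∧
    (∀ m : ℕ, 1 ≤ m → m ≤ 5 →
      ∃ (Z : Fin 3 → SourceLocalization.Plane) (d : Fin 3 → ℝ),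
        AffineIndependent ℝ Z ∧ (∀ i, 0 ≤ d i) ∧
          (SourceLocalization.solutionSet (fun y => y ^ 2) Z d).encard = m) := by
  refine ⟨fun Z d hZ hd => ?_, SourceLocalization.exists_encard_solutionSet_eq_natCast⟩
  obtain ⟨C, p, hC⟩ := SourceLocalization.exists_radicalCenter hZ d
  have hne := SourceLocalization.minimizers_nonempty hZ hC
  rw [SourceLocalization.encard_solutionSet_eq hZ hC]
  refine ⟨fun hE => ?_, fun hE => ?_⟩
  · have hp := SourceLocalization.neg_of_exceptional hZ hd hC hE
    exact ⟨SourceLocalization.solutionSet_subset_candidatePoints hZ hd hC hp,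
      Set.one_le_encard_iff_nonempty.2 hne,
      SourceLocalization.encard_minimizers_le_five
        (SourceLocalization.pencilEquiv_one_zero _ _) hp hne⟩
  · have hp : 0 ≤ p := by
      by_contra! hp
      exact hE (SourceLocalization.exceptional_of_neg hZ hd hC hp)
    exact le_antisymm
      (Set.encard_le_one_iff_subsingleton.2 (SourceLocalization.minimizers_subsingleton hp))
      (Set.one_le_encard_iff_nonempty.2 hne)
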